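/- Let $(X,\mathcal B,\mu)$ be a standard Borel space with a nonzero $\sigma$-finite measure $\mu$ without atoms. For a measure space $(Y,\mathcal C,\nu)$ let $Y^*$ be the space of countable subsets of $Y$ with the $\sigma$-algebra generated by the sets $\{\omega : |\omega\cap B|=n\}$ ($B\in\mathcal C$, $n\ge 0$), and let $\nu^*$ be the law on $Y^*$ of the Poisson point process with intensity $\nu$: under $\nu^*$, the counts $|\omega\cap A_i|$ of pairwise disjoint sets $A_1,\dots,A_n\in\mathcal C$ are independent, and $|\omega\cap A|$ is Poisson distributed with expectation $\nu(A)$ for every $A\in\mathcal C$ (almost surely infinite if $\nu(A)=\infty$). An action $T$ of a group on $Y$ induces the action $T_*\omega=\{Ty : y\in\omega\}$ on $Y^*$. A Poisson matching is a map $\Psi:X^*\times X^*\to (X\times X)^*$, measurable with respect to the $\mu^*\times\mu^*$-completion, such that for all $B_1,B_2\in\mathcal B$ and $\mu^*\times\mu^*$-almost every $(\omega_1,\omega_2)$: (M1) $|\Psi(\omega_1,\omega_2)\cap(B_1\times B_2)|\le\min\{|\omega_1\cap B_1|,|\omega_2\cap B_2|\}$; (M2) $|\Psi(\omega_1,\omega_2)\cap(B_1\times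 X)|=|\omega_1\cap B_1|$; (M3) $|\Psi(\omega_1,\omega_2)\cap(X\times B_2)|=|\omega_2\cap B_2|$. Given an action $T$ of a group $G$ on $X$, the matching is $T$-equivariant if, for every $g\in G$, $\Psi(T_{g*}\omega_1,T_{g*}\omega_2)=(T_g\times T_g)_*\Psi(\omega_1,\omega_2)$ for $\mu^*\times\mu^*$-almost every $(\omega_1,\omega_2)$. Let $T$ be an action of a group $G$ on $X$ by measurable, $\mu$-preserving transformations, and let $S=T\times T_*$ be the diagonal action of $G$ on $(X\times X^*,\mu\times\mu^*)$. Suppose that the action $S\times S_*$ of $G$ on $(X\times X^*)\times(X\times X^*)^*$ is ergodic with respect to $(\mu\times\mu^*)\times(\mu\times\mu^*)^*$, that is, every measurable set $A$ for which $gA$ and $A$ agree up to a null set for each $g\in G$ is null or has null complement. Then there is no $T$-equivariant Poisson matching. -/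

import Mathlib

open MeasureTheory ProbabilityTheory
open scoped Nat

/-- The space `X^*` of countable subsets of `X`. -/
@[ext]
structure Config (X : Type*) where
  carrier : Set X
  countable : carrier.Countable

namespace Config

/-- The number of points `|ω ∩ B|` of `ω` in `B`, an element of `{0, 1, 2, …, ∞}`. -/
noncomputable def count {X : Type*} (ω : Config X) (B : Set X) : ℕ∞ :=
  (ω.carrier ∩ B).encard

/-- The σ-algebra on `X^*` generated by the sets `[|ω ∩ B| = n]`, `B` measurable, `n ≥ 0`. -/
instance instMeasurableSpace {X : Type*} [MeasurableSpace X] : MeasurableSpace (Config X) :=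
  MeasurableSpace.generateFrom
    {S | ∃ (B : Set X) (n : ℕ), MeasurableSet B ∧ S = {ω : Config X | ω.count B = n}}

/-- The suspended action `T_*`: a group element `g` sends `ω` to `{g • x : x ∈ ω}`. -/
instance instMulAction {G X : Type*} [Group G] [MulAction G X] : MulAction G (Config X) where
  smul g ω := ⟨(fun x => g • x) '' ω.carrier, ω.countable.image _⟩
  one_smul ω := by
    apply Config.ext
    change (fun x => (1 : G) • x) '' ω.carrier = ω.carrier
    simp
  mul_smul g h ω := by
    apply Config.ext
    change (fun x => (g * h) • x) '' ω.carrier =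
      (fun x => g • x) '' ((fun x => h • x) '' ω.carrier)
    rw [Set.image_image]
    simp only [mul_smul]

end Config

/-- `P` is the law `μ^*` of the Poisson point process on `X` with intensity `μ`: the numbers of
points in disjoint measurable sets `A₁, …, Aₙ` are independent, and the number of points in a
measurable set `A` is Poisson with expectation `μ A` (almost surely infinite if `μ A = ∞`). -/
structure IsPoissonProcess {X : Type*} [MeasurableSpace X] (μ : Measure X)
    (P : Measure (Config X)) : Prop where
  isProbabilityMeasure : IsProbabilityMeasure P
  measure_count_eq : ∀ A : Set X, MeasurableSet A → ∀ k : ℕ,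
    P {ω | ω.count A = k} =
      if μ A = ⊤ then 0
      else ENNReal.ofReal (Real.exp (-(μ A).toReal) * (μ A).toReal ^ k / k !)
  iIndepFun_count : ∀ (n : ℕ) (A : Fin n → Set X), (∀ i, MeasurableSet (A i)) →
    Pairwise (fun i j => Disjoint (A i) (A j)) →
    iIndepFun (fun i (ω : Config X) => ω.count (A i)) P

/-- A (deterministic) Poisson matching, where `P` is the law of the Poisson process on `X`:
a measurable map `Ψ : X^* × X^* → (X × X)^*` (measurability with respect to the completion is
enough) which, for almost every pair `(ω₁, ω₂)` of independent Poisson realizations, is a perfect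
matching of the points of `ω₁` with the points of `ω₂`. -/
structure IsPoissonMatching {X : Type*} [MeasurableSpace X] (P : Measure (Config X))
    (Ψ : Config X × Config X → Config (X × X)) : Prop where
  aemeasurable : AEMeasurable Ψ (P.prod P)
  count_prod_le : ∀ B₁ B₂ : Set X, MeasurableSet B₁ → MeasurableSet B₂ →
    ∀ᵐ ω₁ ∂P, ∀ᵐ ω₂ ∂P, (Ψ (ω₁, ω₂)).count (B₁ ×ˢ B₂) ≤ min (ω₁.count B₁) (ω₂.count B₂)
  count_fst : ∀ B₁ : Set X, MeasurableSet B₁ →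
    ∀ᵐ ω₁ ∂P, ∀ᵐ ω₂ ∂P, (Ψ (ω₁, ω₂)).count (B₁ ×ˢ Set.univ) = ω₁.count B₁
  count_snd : ∀ B₂ : Set X, MeasurableSet B₂ →
    ∀ᵐ ω₂ ∂P, ∀ᵐ ω₁ ∂P, (Ψ (ω₁, ω₂)).count (Set.univ ×ˢ B₂) = ω₂.count B₂

/-- `Ψ` is equivariant: for every `g`, `Ψ (T_* ω₁, T_* ω₂) = (T × T)_* Ψ (ω₁, ω₂)` for almost
every `(ω₁, ω₂)`, where `T` is the action of `g`. -/
def IsEquivariantMatching (G : Type*) {X : Type*} [Group G] [MulAction G X] [MeasurableSpace X]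
    (P : Measure (Config X)) (Ψ : Config X × Config X → Config (X × X)) : Prop :=
  ∀ g : G, ∀ᵐ ω ∂(P.prod P), Ψ (g • ω.1, g • ω.2) = g • Ψ ω

/-!
Ergodicity of `S × S_*` passes to the factor `X × X^*`, and that alone excludes a matching.
If `D ⊆ X × X` is invariant, then so is the set of pairs `(x, ω)` for which `ω` avoids the section
`D_x`, so this set is null or conull. As `ω` avoids `D_x` with probability `exp (-μ D_x)`, almost
every section of `D` is null or almost every section of `D` has infinite measure.

The intensity of the matched pairs of an equivariant matching is an invariant measure on `X × X`.
Its marginal is `μ`, and independence of the two configurations together with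
`min a b ≤ a * b` bounds it by `μ × μ`. Its density is therefore an invariant function with integral
one on almost every section. A superlevel set at a positive height is invariant with sections of
finite measure, hence with null sections, so the density vanishes on almost every section.
-/

open Set Filter
open scoped ENNReal symmDiff

section MeasureComparison

variable {α β : Type*}

theorem isSetSemiring_image2_prod_of_isSetRing {C : Set (Set α)} {D : Set (Set β)}
    (hC : IsSetRing C) (hD : IsSetRing D) : IsSetSemiring (image2 (· ×ˢ ·) C D) where
  empty_mem := ⟨∅, hC.empty_mem, ∅, hD.empty_mem, empty_prod⟩
  inter_mem := by
    rintro _ ⟨s, hs, t, ht, rfl⟩ _ ⟨s', hs', t', ht', rfl⟩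
    exact ⟨s ∩ s', hC.inter_mem hs hs', t ∩ t', hD.inter_mem ht ht', prod_inter_prod.symm⟩
  sdiff_eq_sUnion' := by
    classical
    rintro _ ⟨s, hs, t, ht, rfl⟩ _ ⟨s', hs', t', ht', rfl⟩
    refine ⟨{(s \ s') ×ˢ t, (s ∩ s') ×ˢ (t \ t')}, ?_, ?_, ?_⟩
    · rw [Finset.coe_pair, pair_subset_iff]
      exact ⟨⟨_, hC.sdiff_mem hs hs', _, ht, rfl⟩,
        ⟨_, hC.inter_mem hs hs', _, hD.sdiff_mem ht ht', rfl⟩⟩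
    · rw [Finset.coe_pair]
      have hdisj : Disjoint ((s \ s') ×ˢ t) ((s ∩ s') ×ˢ (t \ t')) :=
        Disjoint.set_prod_left (disjoint_sdiff_left.mono_right inter_subset_right) _ _
      exact pairwise_pair.2 fun _ => ⟨hdisj, hdisj.symm⟩
    · ext ⟨x, y⟩
      simp only [Set.mem_sdiff, mem_prod, Finset.coe_pair, sUnion_pair, mem_union, mem_inter_iff]
      tauto

variable [MeasurableSpace α] [MeasurableSpace β]

theorem isSetRing_measurableSet : IsSetRing {s : Set α | MeasurableSet s} where
  empty_mem := .empty
  union_mem _ _ := .union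
  sdiff_mem _ _ := .diff

variable {ρ ν : Measure α}

theorem measure_le_of_mem_supClosure {C : Set (Set α)} (hC : IsSetSemiring C)
    (hCm : ∀ s ∈ C, MeasurableSet s) (h : ∀ s ∈ C, ρ s ≤ ν s) {t : Set α}
    (ht : t ∈ supClosure C) : ρ t ≤ ν t := by
  obtain ⟨p, hp⟩ := hC.mem_supClosure_iff.1 ht
  have ht_eq : t = ⋃ u ∈ p.parts, u :=
    p.sup_parts.symm.trans ((Finset.sup_id_set_eq_sUnion _).trans sUnion_eq_biUnion)
  have measure_eq_sum (m : Measure α) : m t = ∑ u ∈ p.parts, m u :=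
    (congrArg m ht_eq).trans (measure_biUnion_finset p.disjoint fun u hu => hCm u (hp hu))
  rw [measure_eq_sum, measure_eq_sum]
  exact Finset.sum_le_sum fun u hu => h u (hp hu)

theorem measure_le_of_isSetSemiring [IsFiniteMeasure ρ] [IsFiniteMeasure ν] {C : Set (Set α)}
    (hC : IsSetSemiring C) (hgen : ‹MeasurableSpace α› = .generateFrom C)
    (hcover : ∃ D : Set (Set α), D.Countable ∧ D ⊆ C ∧ ⋃₀ D = univ)
    (h : ∀ s ∈ C, ρ s ≤ ν s) : ρ ≤ ν := by
  refine Measure.le_iff.2 fun s hs => ENNReal.le_of_forall_pos_le_add fun ε hε _ => ?_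
  obtain ⟨t, htC, ht⟩ := exists_measure_symmDiff_lt_of_generateFrom_isSetSemiring (μ := ρ + ν) hC
    (hcover.imp fun D hD => ⟨hD.1, hD.2.1, by simp [hD.2.2]⟩) hgen hs (ENNReal.coe_pos.2 hε)
  have hCm : ∀ s ∈ C, MeasurableSet s := fun s hs =>
    hgen ▸ MeasurableSpace.measurableSet_generateFrom hs
  have ht_le : ρ t ≤ ν t := measure_le_of_mem_supClosure hC hCm h htC
  calc ρ s ≤ ρ (t ∆ s ∪ t) := measure_mono (le_symmDiff_sup_left t s)
    _ ≤ ρ (t ∆ s) + ρ t := measure_union_le _ _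
    _ ≤ ρ (t ∆ s) + ν t := by gcongr
    _ ≤ ρ (t ∆ s) + ν (t ∆ s ∪ s) := by gcongr; exact le_symmDiff_sup_right t s
    _ ≤ ρ (t ∆ s) + (ν (t ∆ s) + ν s) := by gcongr; exact measure_union_le _ _
    _ = ν s + (ρ + ν) (t ∆ s) := by rw [Measure.add_apply, ← add_assoc, add_comm]
    _ ≤ ν s + ε := by gcongr

theorem measure_le_of_restrict_le {S : ℕ → Set α} (hS : Monotone S) (hS_univ : ⋃ n, S n = univ)
    (h : ∀ n, ρ.restrict (S n) ≤ ν.restrict (S n)) : ρ ≤ ν := by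
  refine Measure.le_iff.2 fun s hs => ?_
  rw [← Measure.restrict_univ (μ := ρ), ← Measure.restrict_univ (μ := ν), ← hS_univ,
    Measure.restrict_iUnion_apply_eq_iSup hS.directed_le hs,
    Measure.restrict_iUnion_apply_eq_iSup hS.directed_le hs]
  exact iSup_mono fun n => h n s

theorem measure_le_prod_of_measurable_rectangles {ρ : Measure (α × β)} {μ : Measure α}
    {ν : Measure β} [SigmaFinite μ] [SigmaFinite ν]
    (h : ∀ s t, MeasurableSet s → MeasurableSet t → ρ (s ×ˢ t) ≤ μ s * ν t) : ρ ≤ μ.prod ν := by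
  refine measure_le_of_restrict_le (S := fun n => spanningSets μ n ×ˢ spanningSets ν n)
    (fun m n hmn => prod_mono (monotone_spanningSets μ hmn) (monotone_spanningSets ν hmn)) ?_
    fun n => ?_
  · rw [iUnion_prod_of_monotone (monotone_spanningSets μ) (monotone_spanningSets ν),
      iUnion_spanningSets, iUnion_spanningSets, univ_prod_univ]
  have hSμ := measurableSet_spanningSets μ n
  have hSν := measurableSet_spanningSets ν n
  have hfin : (μ.prod ν) (spanningSets μ n ×ˢ spanningSets ν n) < ∞ := by
    rw [Measure.prod_prod]
    exact ENNReal.mul_lt_top (measure_spanningSets_lt_top μ n) (measure_spanningSets_lt_top ν n)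
  have : IsFiniteMeasure (ρ.restrict (spanningSets μ n ×ˢ spanningSets ν n)) :=
    isFiniteMeasure_restrict.2
      ((h _ _ hSμ hSν).trans_lt (Measure.prod_prod (μ := μ) (ν := ν) _ _ ▸ hfin)).ne
  have : IsFiniteMeasure ((μ.prod ν).restrict (spanningSets μ n ×ˢ spanningSets ν n)) :=
    isFiniteMeasure_restrict.2 hfin.ne
  refine measure_le_of_isSetSemiring (isSetSemiring_image2_prod_of_isSetRing isSetRing_measurableSet
    isSetRing_measurableSet) generateFrom_prod.symm ⟨{univ}, countable_singleton _,
      singleton_subset_iff.2 ⟨univ, .univ, univ, .univ, univ_prod_univ⟩, sUnion_singleton _⟩ ?_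
  rintro _ ⟨s, hs, t, ht, rfl⟩
  rw [Measure.restrict_apply (hs.prod ht), Measure.restrict_apply (hs.prod ht),
    prod_inter_prod, Measure.prod_prod]
  exact h _ _ (hs.inter hSμ) (ht.inter hSν)

end MeasureComparison

section Density

variable {α β : Type*} [MeasurableSpace α] [MeasurableSpace β]

theorem rnDeriv_comp_ae_eq_of_measurePreserving {ρ ν : Measure α} {ρ' ν' : Measure β}
    [SigmaFinite ν] [SFinite ν'] [ρ'.HaveLebesgueDecomposition ν'] (hρν' : ρ' ≪ ν') {e : α → β}
    (he : MeasurableEmbedding e) (hρ : MeasurePreserving e ρ ρ')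
    (hν : MeasurePreserving e ν ν') :
    ρ'.rnDeriv ν' ∘ e =ᵐ[ν] ρ.rnDeriv ν := by
  have hdens : ν.withDensity (ρ'.rnDeriv ν' ∘ e) = ρ := Measure.ext fun s hs =>
    calc ν.withDensity (ρ'.rnDeriv ν' ∘ e) s
        = ∫⁻ x in s, ρ'.rnDeriv ν' (e x) ∂ν := withDensity_apply _ hs
      _ = ∫⁻ y in e '' s, ρ'.rnDeriv ν' y ∂ν' := hν.setLIntegral_comp_emb he _ _
      _ = ρ' (e '' s) := Measure.setLIntegral_rnDeriv hρν' _
      _ = ρ s := by rw [← hρ.measure_preimage_emb he, preimage_image_eq _ he.injective]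
  rw [← hdens]
  exact (Measure.rnDeriv_withDensity ν
    ((Measure.measurable_rnDeriv ρ' ν').comp he.measurable)).symm

theorem ae_lintegral_rnDeriv_prod_eq_one {ρ : Measure (α × β)} {μ : Measure α} {ν : Measure β}
    [SigmaFinite μ] [SFinite ν] [ρ.HaveLebesgueDecomposition (μ.prod ν)]
    (hρ : ρ ≪ μ.prod ν) (hfst : ρ.fst = μ) :
    ∀ᵐ x ∂μ, ∫⁻ y, ρ.rnDeriv (μ.prod ν) (x, y) ∂ν = 1 := by
  have hf := Measure.measurable_rnDeriv ρ (μ.prod ν)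
  refine ae_eq_of_forall_setLIntegral_eq_of_sigmaFinite hf.lintegral_prod_right'
    measurable_const fun s hs _ => ?_
  calc ∫⁻ x in s, ∫⁻ y, ρ.rnDeriv (μ.prod ν) (x, y) ∂ν ∂μ
      = ∫⁻ z in s ×ˢ univ, ρ.rnDeriv (μ.prod ν) z ∂μ.prod ν := by
        rw [setLIntegral_prod _ hf.aemeasurable, Measure.restrict_univ]
    _ = ρ.fst s := by rw [Measure.setLIntegral_rnDeriv hρ, Measure.fst_apply hs, prod_univ]
    _ = ∫⁻ _ in s, 1 ∂μ := by rw [hfst, setLIntegral_one]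

theorem measure_lt_ne_top_of_lintegral_ne_top {μ : Measure α} {f : α → ℝ≥0∞}
    (hf : AEMeasurable f μ) (h : ∫⁻ x, f x ∂μ ≠ ∞) {c : ℝ≥0∞} (hc : c ≠ 0) :
    μ {x | c < f x} ≠ ∞ := by
  rcases eq_or_ne c ∞ with rfl | hc'
  · simp only [not_top_lt, ofPred_false, measure_empty, ne_eq, ENNReal.zero_ne_top,
      not_false_eq_true]
  refine ne_top_of_le_ne_top (ENNReal.div_ne_top h hc) ?_
  calc μ {x | c < f x} ≤ μ {x | c ≤ f x} := measure_mono fun _ (hx : c < _) => hx.le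
    _ ≤ (∫⁻ x, f x ∂μ) / c := meas_ge_le_lintegral_div hf hc hc'

theorem ae_eq_zero_of_forall_measure_inv_lt_eq_zero {μ : Measure α} {f : α → ℝ≥0∞}
    (h : ∀ n : ℕ, μ {x | (n : ℝ≥0∞)⁻¹ < f x} = 0) : f =ᵐ[μ] 0 := by
  filter_upwards [ae_all_iff.2 fun n => measure_eq_zero_iff_ae_notMem.1 (h n)] with x hx
  by_contra hfx
  exact (ENNReal.exists_inv_nat_lt hfx).elim hx

end Density

section Action

variable {G α β : Type*} [Group G] [MulAction G α] [MulAction G β]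
  [MeasurableSpace α] [MeasurableSpace β]

instance instMeasurableConstSMulProd [MeasurableConstSMul G α] [MeasurableConstSMul G β] :
    MeasurableConstSMul G (α × β) where
  measurable_const_smul g := (measurable_fst.const_smul g).prodMk (measurable_snd.const_smul g)

theorem ergodicSMul_fst_of_prod [MeasurableConstSMul G α] {μ : Measure α} {ν : Measure β}
    [SFinite μ] [IsProbabilityMeasure ν] (h : ErgodicSMul G (α × β) (μ.prod ν)) :
    ErgodicSMul G α μ where
  measure_preimage_smul g s hs := by
    have hfst : MeasurePreserving Prod.fst (μ.prod ν) μ := measurePreserving_fst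
    rw [← hfst.measure_preimage hs.nullMeasurableSet,
      ← hfst.measure_preimage (measurable_const_smul g hs).nullMeasurableSet]
    exact h.measure_preimage_smul g (measurable_fst hs)
  aeconst_of_forall_preimage_smul_ae_eq {s} hs hinv := by
    have hfst : MeasurePreserving Prod.fst (μ.prod ν) μ := measurePreserving_fst
    have hconst := h.aeconst_of_forall_preimage_smul_ae_eq (measurable_fst hs)
      fun g => hfst.quasiMeasurePreserving.preimage_ae_eq (hinv g)
    rw [eventuallyConst_set] at hconst ⊢
    rw [← hfst.map_eq]
    exact hconst.imp (ae_map_iff hfst.aemeasurable hs).2 (ae_map_iff hfst.aemeasurable hs.compl).2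

theorem smulInvariantMeasure_snd_of_prod [MeasurableConstSMul G α] [MeasurableConstSMul G β]
    {μ : Measure α} {ν : Measure β} [SigmaFinite μ] [SFinite ν] [NeZero μ]
    [SMulInvariantMeasure G α μ] [SMulInvariantMeasure G (α × β) (μ.prod ν)] :
    SMulInvariantMeasure G β ν where
  measure_preimage_smul g t _ := by
    obtain ⟨s, -, -, hs_pos, hs_top⟩ :=
      Measure.exists_subset_measure_lt_top .univ (NeZero.pos (μ univ))
    refine (ENNReal.mul_right_inj hs_pos.ne' hs_top.ne).1 ?_
    calc μ s * ν ((g • ·) ⁻¹' t)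
        = (μ.prod ν) ((g • ·) ⁻¹' (s ×ˢ t)) := by
          rw [← measure_preimage_smul μ g s, ← Measure.prod_prod]; rfl
      _ = μ s * ν t := by rw [measure_preimage_smul, Measure.prod_prod]

end Action

namespace Config

variable {X β : Type*}

theorem count_smul {G : Type*} [Group G] [MulAction G X] (g : G) (ω : Config X) (B : Set X) :
    (g • ω).count B = ω.count ((g • ·) ⁻¹' B) := by
  change ((g • ·) '' ω.carrier ∩ B).encard = _
  rw [count, ← image_inter_preimage, (MulAction.injective g).injOn.encard_image]

theorem count_eq_zero_iff {ω : Config X} {B : Set X} :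
    ω.count B = 0 ↔ Disjoint ω.carrier B := by
  rw [count, encard_eq_zero, disjoint_iff_inter_eq_empty]

theorem count_eq_zero_iff_forall_inter {ω : Config X} {B : Set X} {S : ℕ → Set X}
    (hS : ⋃ n, S n = univ) : ω.count B = 0 ↔ ∀ n, ω.count (B ∩ S n) = 0 := by
  simp_rw [count_eq_zero_iff, ← disjoint_iUnion_right, ← inter_iUnion, hS, inter_univ]

/-- The pairs `(b, ω)` for which `ω` has no point in the section of `D` at `b`: the set through
which ergodicity of `β × X^*` controls the sections of `D`. -/
def avoidingSet (D : Set (β × X)) : Set (β × Config X) :=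
  {p | p.2.count (Prod.mk p.1 ⁻¹' D) = 0}

theorem preimage_smul_avoidingSet {G : Type*} [Group G] [MulAction G X] [MulAction G β] (g : G)
    (D : Set (β × X)) : (g • ·) ⁻¹' avoidingSet D = avoidingSet ((g • ·) ⁻¹' D) := by
  ext p
  simp only [avoidingSet, mem_preimage, mem_ofPred_eq, Prod.smul_fst, Prod.smul_snd, count_smul]
  rfl

theorem mem_avoidingSet_iff_of_notMem_symmDiff {D D' : Set (β × X)} {p : β × Config X}
    (hp : p ∈ avoidingSet (D ∆ D')) : p ∈ avoidingSet D ↔ p ∈ avoidingSet D' := by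
  simp only [avoidingSet, mem_ofPred_eq, count_eq_zero_iff, disjoint_left] at hp ⊢
  refine forall₂_congr fun x hx => not_congr ?_
  simpa [mem_symmDiff, iff_iff_implies_and_implies, imp_iff_not_or] using hp hx

/-- The counting measure of a configuration, written as a sum of Dirac masses so that its value on
every measurable set is the number of points there, whether or not points are measurable. -/
noncomputable def toMeasure [MeasurableSpace X] (ω : Config X) : Measure X :=
  Measure.sum fun x : ω.carrier => Measure.dirac (x : X)

variable [MeasurableSpace X] [MeasurableSpace β]

theorem toMeasure_apply (ω : Config X) {B : Set X} (hB : MeasurableSet B) :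
    ω.toMeasure B = ω.count B := by
  rw [toMeasure, Measure.sum_apply _ hB]
  simp_rw [Measure.dirac_apply' _ hB]
  rw [tsum_subtype ω.carrier (B.indicator 1), indicator_indicator, ← tsum_subtype]
  exact ENNReal.tsum_set_one _

theorem measurable_count {B : Set X} (hB : MeasurableSet B) :
    Measurable fun ω : Config X => ω.count B :=
  ENat.measurable_iff.2 fun n => MeasurableSpace.measurableSet_generateFrom ⟨B, n, hB, rfl⟩

theorem measurable_toENNReal_count {B : Set X} (hB : MeasurableSet B) :
    Measurable fun ω : Config X => (ω.count B : ℝ≥0∞) :=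
  (measurable_from_top (f := ENat.toENNReal)).comp (measurable_count hB)

theorem measurable_toMeasure : Measurable (toMeasure : Config X → Measure X) :=
  Measure.measurable_of_measurable_coe _ fun B hB => by
    simpa only [toMeasure_apply _ hB] using measurable_toENNReal_count hB

instance instMeasurableConstSMul {G : Type*} [Group G] [MulAction G X] [MeasurableConstSMul G X] :
    MeasurableConstSMul G (Config X) where
  measurable_const_smul g := by
    refine measurable_generateFrom ?_
    rintro _ ⟨B, n, hB, rfl⟩
    simp only [preimage_ofPred_eq, count_smul]
    exact measurable_count (measurable_const_smul g hB) (measurableSet_singleton (n : ℕ∞))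

open scoped Classical in
/-- The restriction of the counting measure of a configuration to `S`, replaced by `0` for
configurations with infinitely many points in `S`, so that it is a kernel of finite measures. -/
noncomputable def truncatedKernel {S : Set X} (hS : MeasurableSet S) : Kernel (Config X) X :=
  Kernel.piecewise (measurable_count hS (measurableSet_singleton ⊤)) 0
    (Kernel.restrict ⟨toMeasure, measurable_toMeasure⟩ hS)

theorem truncatedKernel_apply {S : Set X} (hS : MeasurableSet S) {ω : Config X}
    (hω : ω.count S ≠ ⊤) : truncatedKernel hS ω = ω.toMeasure.restrict S := by
  classical
  rw [truncatedKernel, Kernel.piecewise_apply, if_neg (by simpa using hω), Kernel.restrict_apply]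
  rfl

instance isFiniteMeasure_truncatedKernel {S : Set X} (hS : MeasurableSet S) (ω : Config X) :
    IsFiniteMeasure (truncatedKernel hS ω) := by
  classical
  by_cases hω : ω.count S = ⊤
  · rw [truncatedKernel, Kernel.piecewise_apply, if_pos (by simpa using hω)]
    infer_instance
  · rw [truncatedKernel_apply hS hω, isFiniteMeasure_restrict, toMeasure_apply _ hS]
    simpa using hω

theorem measurableSet_avoidingSet_inter {D : Set (β × X)} (hD : MeasurableSet D) {S : Set X}
    (hS : MeasurableSet S) :
    MeasurableSet (avoidingSet (D ∩ univ ×ˢ S) ∩ {p | p.2.count S ≠ ⊤}) := by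
  let κ : Kernel (β × Config X) X := (truncatedKernel hS).comap Prod.snd measurable_snd
  let T : Set ((β × Config X) × X) := (fun q => (q.1.1, q.2)) ⁻¹' D
  have hT : MeasurableSet T := (measurable_fst.fst.prodMk measurable_snd) hD
  have hκ : Measurable fun p => κ p (Prod.mk p ⁻¹' T) :=
    Kernel.measurable_kernel_prodMk_left_of_finite hT fun p =>
      isFiniteMeasure_truncatedKernel hS p.2
  have hfin : MeasurableSet {p : β × Config X | p.2.count S ≠ ⊤} :=
    ((measurable_count hS).comp measurable_snd (measurableSet_singleton ⊤)).compl
  convert (hκ (measurableSet_singleton 0)).inter hfin using 1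
  ext p
  refine and_congr_left fun hp => ?_
  have hsec : MeasurableSet (Prod.mk p.1 ⁻¹' D) := measurable_prodMk_left hD
  have : κ p (Prod.mk p ⁻¹' T) = p.2.count (Prod.mk p.1 ⁻¹' (D ∩ univ ×ˢ S)) := by
    change truncatedKernel hS p.2 (Prod.mk p.1 ⁻¹' D) = _
    rw [truncatedKernel_apply hS hp, Measure.restrict_apply hsec,
      toMeasure_apply _ (hsec.inter hS), preimage_inter, mk_preimage_prod_right (mem_univ _)]
  simp [avoidingSet, this]

theorem measurableSet_avoidingSet_inter_iInter {D : Set (β × X)} (hD : MeasurableSet D)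
    {S : ℕ → Set X} (hS : ∀ n, MeasurableSet (S n)) (hS_univ : ⋃ n, S n = univ) :
    MeasurableSet (avoidingSet D ∩ ⋂ n, {p | p.2.count (S n) ≠ ⊤}) := by
  have hsplit : avoidingSet D = ⋂ n, avoidingSet (D ∩ univ ×ˢ S n) := by
    ext p
    simp only [avoidingSet, mem_iInter, mem_ofPred_eq, preimage_inter,
      mk_preimage_prod_right (mem_univ _)]
    exact count_eq_zero_iff_forall_inter hS_univ
  rw [hsplit, ← iInter_inter_distrib]
  exact .iInter fun n => measurableSet_avoidingSet_inter hD (hS n)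

end Config

section PoissonMean

open scoped NNReal

theorem natCast_succ_mul_poissonMeasure_singleton (r : ℝ≥0) (k : ℕ) :
    ((k + 1 : ℕ) : ℝ≥0∞) * Po(r) {k + 1} = r * Po(r) {k} := by
  rw [poissonMeasure_singleton, poissonMeasure_singleton, ← ENNReal.ofReal_natCast,
    ← ENNReal.ofReal_coe_nnreal, ← ENNReal.ofReal_mul (by positivity),
    ← ENNReal.ofReal_mul (by positivity), Nat.factorial_succ]
  congr 1
  push_cast
  field_simp
  ring

theorem lintegral_natCast_poissonMeasure (r : ℝ≥0) : ∫⁻ k, (k : ℝ≥0∞) ∂Po(r) = r :=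
  calc ∫⁻ k, (k : ℝ≥0∞) ∂Po(r)
      = ∑' k : ℕ, (k : ℝ≥0∞) * Po(r) {k} := lintegral_countable' _
    _ = ∑' k : ℕ, ((k + 1 : ℕ) : ℝ≥0∞) * Po(r) {k + 1} := by
        rw [tsum_eq_zero_add' ENNReal.summable, Nat.cast_zero, zero_mul, zero_add]
    _ = ∑' k : ℕ, r * Po(r) {k} := by simp_rw [natCast_succ_mul_poissonMeasure_singleton]
    _ = ∫⁻ _, r ∂Po(r) := (lintegral_countable' _).symm
    _ = r := by rw [lintegral_const, measure_univ, mul_one]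

end PoissonMean

namespace IsPoissonProcess

variable {X : Type*} [MeasurableSpace X] {μ : Measure X} {P : Measure (Config X)}

theorem map_count (hP : IsPoissonProcess μ P) {A : Set X} (hA : MeasurableSet A) (h : μ A ≠ ⊤) :
    P.map (fun ω => ω.count A) = Po(ℕ∞, (μ A).toNNReal) := by
  have := hP.isProbabilityMeasure
  have hcount := Config.measurable_count hA
  have := Measure.isProbabilityMeasure_map (μ := P) hcount.aemeasurable
  have hcast : MeasurableEmbedding (Nat.cast : ℕ → ℕ∞) :=
    ⟨Nat.cast_injective, .of_discrete, fun _ _ => .of_discrete⟩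
  have hcomap : (P.map fun ω => ω.count A).comap Nat.cast = Po((μ A).toNNReal) := by
    refine Measure.ext_of_singleton fun k => ?_
    rw [hcast.comap_apply, image_singleton, Measure.map_apply hcount (measurableSet_singleton _),
      poissonMeasure_singleton]
    exact (hP.measure_count_eq A hA k).trans (if_neg h)
  refine (Measure.eq_of_le_of_isProbabilityMeasure ?_).symm
  rw [← hcomap, hcast.map_comap]
  exact Measure.restrict_le_self

theorem ae_count_ne_top (hP : IsPoissonProcess μ P) {A : Set X} (hA : MeasurableSet A)
    (h : μ A ≠ ⊤) : ∀ᵐ ω ∂P, ω.count A ≠ ⊤ := by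
  refine ae_of_ae_map (p := (· ≠ ⊤)) (Config.measurable_count hA).aemeasurable ?_
  rw [hP.map_count hA h, ae_map_iff .of_discrete .of_discrete]
  exact .of_forall ENat.natCast_ne_top

theorem ae_count_eq_top (hP : IsPoissonProcess μ P) {A : Set X} (hA : MeasurableSet A)
    (h : μ A = ⊤) : ∀ᵐ ω ∂P, ω.count A = ⊤ := by
  have hne : ∀ᵐ ω ∂P, ∀ k : ℕ, ω.count A ≠ (k : ℕ∞) := ae_all_iff.2 fun k => by
    rw [ae_iff]
    simpa only [not_not, if_pos h] using hP.measure_count_eq A hA k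
  filter_upwards [hne] with ω hω
  exact ENat.eq_top_iff_forall_ne.2 fun k => (hω k).symm

theorem lintegral_count (hP : IsPoissonProcess μ P) {A : Set X} (hA : MeasurableSet A) :
    ∫⁻ ω, (ω.count A : ℝ≥0∞) ∂P = μ A := by
  have := hP.isProbabilityMeasure
  by_cases h : μ A = ⊤
  · rw [lintegral_congr_ae ((hP.ae_count_eq_top hA h).mono fun ω hω => congrArg _ hω),
      lintegral_const, measure_univ, mul_one, h]
    rfl
  · calc ∫⁻ ω, (ω.count A : ℝ≥0∞) ∂P
        = ∫⁻ n : ℕ∞, (n : ℝ≥0∞) ∂P.map (fun ω => ω.count A) :=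
          (lintegral_map measurable_from_top (Config.measurable_count hA)).symm
      _ = ∫⁻ k : ℕ, (k : ℝ≥0∞) ∂Po((μ A).toNNReal) := by
          rw [hP.map_count hA h, lintegral_map measurable_from_top .of_discrete]; simp
      _ = μ A := by rw [lintegral_natCast_poissonMeasure, ENNReal.coe_toNNReal h]

theorem measure_count_eq_zero (hP : IsPoissonProcess μ P) {A : Set X} (hA : MeasurableSet A) :
    P {ω | ω.count A = 0} = if μ A = ⊤ then 0 else ENNReal.ofReal (Real.exp (-(μ A).toReal)) := by
  simpa using hP.measure_count_eq A hA 0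

theorem ae_count_eq_zero_iff (hP : IsPoissonProcess μ P) {A : Set X} (hA : MeasurableSet A) :
    (∀ᵐ ω ∂P, ω.count A = 0) ↔ μ A = 0 := by
  rw [← hP.lintegral_count hA, lintegral_eq_zero_iff (Config.measurable_toENNReal_count hA)]
  exact eventually_congr (.of_forall fun ω => ENat.toENNReal_eq_zero.symm)

theorem measure_eq_top_of_ae_count_ne_zero (hP : IsPoissonProcess μ P) {A : Set X}
    (hA : MeasurableSet A) (h : ∀ᵐ ω ∂P, ω.count A ≠ 0) : μ A = ⊤ := by
  have hzero : P {ω | ω.count A = 0} = 0 := by simpa [ae_iff] using h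
  by_contra htop
  rw [hP.measure_count_eq_zero hA, if_neg htop, ENNReal.ofReal_eq_zero] at hzero
  exact (Real.exp_pos _).not_ge hzero

theorem ae_forall_count_spanningSets_ne_top [SigmaFinite μ] (hP : IsPoissonProcess μ P) :
    ∀ᵐ ω ∂P, ∀ n, ω.count (spanningSets μ n) ≠ ⊤ :=
  ae_all_iff.2 fun n => hP.ae_count_ne_top (measurableSet_spanningSets μ n)
    (measure_spanningSets_lt_top μ n).ne

section ZeroOneLaw

variable {β : Type*} [MeasurableSpace β] {m : Measure β} [SigmaFinite μ]

theorem avoidingSet_inter_ae_eq (hP : IsPoissonProcess μ P) (D : Set (β × X)) :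
    (Config.avoidingSet D ∩ ⋂ n, {p | p.2.count (spanningSets μ n) ≠ ⊤} : Set (β × Config X))
      =ᵐ[m.prod P] Config.avoidingSet D := by
  have := hP.isProbabilityMeasure
  refine inter_ae_eq_left_of_ae_eq_univ (eventuallyEq_univ.2 ?_)
  filter_upwards [Measure.quasiMeasurePreserving_snd.ae hP.ae_forall_count_spanningSets_ne_top]
    with p hp
  exact mem_iInter.2 hp

theorem nullMeasurableSet_avoidingSet (hP : IsPoissonProcess μ P) {D : Set (β × X)}
    (hD : MeasurableSet D) : NullMeasurableSet (Config.avoidingSet D) (m.prod P) :=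
  (Config.measurableSet_avoidingSet_inter_iInter hD (measurableSet_spanningSets μ)
    (iUnion_spanningSets μ)).nullMeasurableSet.congr (hP.avoidingSet_inter_ae_eq D)

theorem ae_mem_avoidingSet_iff (hP : IsPoissonProcess μ P) {D : Set (β × X)}
    (hD : MeasurableSet D) :
    (∀ᵐ p ∂m.prod P, p ∈ Config.avoidingSet D) ↔ ∀ᵐ b ∂m, μ (Prod.mk b ⁻¹' D) = 0 := by
  have := hP.isProbabilityMeasure
  calc (∀ᵐ p ∂m.prod P, p ∈ Config.avoidingSet D)
      ↔ ∀ᵐ p ∂m.prod P, p ∈ Config.avoidingSet D ∩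
          ⋂ n, {p | p.2.count (spanningSets μ n) ≠ ⊤} :=
        eventually_congr (hP.avoidingSet_inter_ae_eq D).symm.mem_iff
    _ ↔ ∀ᵐ b ∂m, ∀ᵐ ω ∂P, ω.count (Prod.mk b ⁻¹' D) = 0 := by
        rw [Measure.ae_prod_mem_iff_ae_ae_mem (Config.measurableSet_avoidingSet_inter_iInter hD
          (measurableSet_spanningSets μ) (iUnion_spanningSets μ))]
        refine eventually_congr (.of_forall fun b => eventually_congr ?_)
        filter_upwards [hP.ae_forall_count_spanningSets_ne_top] with ω hω
        exact and_iff_left (mem_iInter.2 hω)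
    _ ↔ ∀ᵐ b ∂m, μ (Prod.mk b ⁻¹' D) = 0 :=
        eventually_congr (.of_forall fun b => hP.ae_count_eq_zero_iff (measurable_prodMk_left hD))

theorem avoidingSet_ae_eq (hP : IsPoissonProcess μ P) {D D' : Set (β × X)}
    (hD : MeasurableSet D) (hD' : MeasurableSet D') (h : D =ᵐ[m.prod μ] D') :
    Config.avoidingSet D =ᵐ[m.prod P] Config.avoidingSet D' := by
  have hsymmDiff := (hP.ae_mem_avoidingSet_iff (hD.symmDiff hD')).2
    (Measure.measure_ae_null_of_prod_null (measure_symmDiff_eq_zero_iff.2 h))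
  exact eventuallyEq_set.2 (hsymmDiff.mono fun _ => Config.mem_avoidingSet_iff_of_notMem_symmDiff)

variable {G : Type*} [Group G] [MulAction G X] [MulAction G β] [MeasurableConstSMul G X]
  [MeasurableConstSMul G β]

theorem ae_measure_section_eq_zero_or_top (hP : IsPoissonProcess μ P)
    (herg : ErgodicSMul G (β × Config X) (m.prod P)) {D : Set (β × X)} (hD : MeasurableSet D)
    (hinv : ∀ g : G, (g • ·) ⁻¹' D =ᵐ[m.prod μ] D) :
    (∀ᵐ b ∂m, μ (Prod.mk b ⁻¹' D) = 0) ∨ ∀ᵐ b ∂m, μ (Prod.mk b ⁻¹' D) = ⊤ := by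
  have := hP.isProbabilityMeasure
  have hconst := aeconst_of_forall_preimage_smul_ae_eq G (hP.nullMeasurableSet_avoidingSet hD)
    fun g => by
      rw [Config.preimage_smul_avoidingSet]
      exact hP.avoidingSet_ae_eq (measurable_const_smul g hD) hD (hinv g)
  refine (eventuallyConst_set.1 hconst).imp (hP.ae_mem_avoidingSet_iff hD).1 fun h => ?_
  filter_upwards [Measure.ae_ae_of_ae_prod h] with b hb
  exact hP.measure_eq_top_of_ae_count_ne_zero (measurable_prodMk_left hD) hb

theorem ae_ae_eq_zero_of_invariant [NeZero m] (hP : IsPoissonProcess μ P)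
    (herg : ErgodicSMul G (β × Config X) (m.prod P)) {f : β × X → ℝ≥0∞} (hf : Measurable f)
    (hinv : ∀ g : G, f ∘ (g • ·) =ᵐ[m.prod μ] f) (hfin : ∀ᵐ b ∂m, ∫⁻ x, f (b, x) ∂μ ≠ ∞) :
    ∀ᵐ b ∂m, (fun x => f (b, x)) =ᵐ[μ] 0 := by
  have hnull : ∀ᵐ b ∂m, ∀ n : ℕ, μ {x | (n : ℝ≥0∞)⁻¹ < f (b, x)} = 0 := by
    refine ae_all_iff.2 fun n => ?_
    have hD : MeasurableSet {z | (n : ℝ≥0∞)⁻¹ < f z} := measurableSet_lt measurable_const hf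
    have hD_inv (g : G) : (g • ·) ⁻¹' {z | (n : ℝ≥0∞)⁻¹ < f z} =ᵐ[m.prod μ]
        {z | (n : ℝ≥0∞)⁻¹ < f z} :=
      (hinv g).mono fun z hz => congrArg ((n : ℝ≥0∞)⁻¹ < ·) hz
    refine (hP.ae_measure_section_eq_zero_or_top herg hD hD_inv).resolve_right fun htop => ?_
    obtain ⟨b, hb_top, hb_fin⟩ := (htop.and hfin).exists
    exact measure_lt_ne_top_of_lintegral_ne_top (hf.comp measurable_prodMk_left).aemeasurable
      hb_fin (ENNReal.inv_ne_zero.2 (ENNReal.natCast_ne_top n)) hb_top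
  exact hnull.mono fun b hb => ae_eq_zero_of_forall_measure_inv_lt_eq_zero hb

end ZeroOneLaw

end IsPoissonProcess

theorem enat_min_le_mul (a b : ℕ∞) : min a b ≤ a * b := by
  rcases eq_or_ne b 0 with rfl | hb
  · exact (min_le_right a 0).trans zero_le
  · exact (min_le_left a b).trans (le_mul_of_one_le_right' (Order.one_le_iff_ne_zero.2 hb))

/-- The intensity of the point process of matched pairs, a measure on `X × X` which assigns to
a set the expected number of matched pairs in it. -/
noncomputable def matchingIntensity {X : Type*} [MeasurableSpace X] (P : Measure (Config X))
    (Ψ : Config X × Config X → Config (X × X)) : Measure (X × X) :=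
  (P.prod P).bind fun ω => (Ψ ω).toMeasure

namespace IsPoissonMatching

variable {X : Type*} [MeasurableSpace X] {μ : Measure X} {P : Measure (Config X)}
  {Ψ : Config X × Config X → Config (X × X)}

theorem aemeasurable_count (hΨ : IsPoissonMatching P Ψ) {C : Set (X × X)}
    (hC : MeasurableSet C) : AEMeasurable (fun ω => ((Ψ ω).count C : ℝ≥0∞)) (P.prod P) :=
  (Config.measurable_toENNReal_count hC).comp_aemeasurable hΨ.aemeasurable

theorem matchingIntensity_apply (hΨ : IsPoissonMatching P Ψ) {C : Set (X × X)}
    (hC : MeasurableSet C) :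
    matchingIntensity P Ψ C = ∫⁻ ω, ((Ψ ω).count C : ℝ≥0∞) ∂P.prod P := by
  have hΨ_meas : AEMeasurable (fun ω => (Ψ ω).toMeasure) (P.prod P) :=
    Config.measurable_toMeasure.comp_aemeasurable hΨ.aemeasurable
  rw [matchingIntensity, Measure.bind_apply hC hΨ_meas]
  simp only [Config.toMeasure_apply _ hC]

theorem fst_matchingIntensity (hΨ : IsPoissonMatching P Ψ) (hP : IsPoissonProcess μ P) :
    (matchingIntensity P Ψ).fst = μ := by
  have := hP.isProbabilityMeasure
  refine Measure.ext fun B hB => ?_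
  have hC : MeasurableSet (B ×ˢ (univ : Set X)) := hB.prod .univ
  calc (matchingIntensity P Ψ).fst B
      = ∫⁻ ω₁, ∫⁻ ω₂, ((Ψ (ω₁, ω₂)).count (B ×ˢ univ) : ℝ≥0∞) ∂P ∂P := by
        rw [Measure.fst_apply hB, ← prod_univ, hΨ.matchingIntensity_apply hC,
          lintegral_prod _ (hΨ.aemeasurable_count hC)]
    _ = ∫⁻ ω₁, ∫⁻ _, (ω₁.count B : ℝ≥0∞) ∂P ∂P :=
        lintegral_congr_ae <| (hΨ.count_fst B hB).mono fun ω₁ h =>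
          lintegral_congr_ae (h.mono fun ω₂ h' => congrArg _ h')
    _ = μ B := by simp only [lintegral_const, measure_univ, mul_one, hP.lintegral_count hB]

theorem matchingIntensity_le_prod [SigmaFinite μ] (hΨ : IsPoissonMatching P Ψ)
    (hP : IsPoissonProcess μ P) : matchingIntensity P Ψ ≤ μ.prod μ := by
  have := hP.isProbabilityMeasure
  refine measure_le_prod_of_measurable_rectangles fun B₁ B₂ hB₁ hB₂ => ?_
  have hC : MeasurableSet (B₁ ×ˢ B₂) := hB₁.prod hB₂
  calc matchingIntensity P Ψ (B₁ ×ˢ B₂)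
      = ∫⁻ ω₁, ∫⁻ ω₂, ((Ψ (ω₁, ω₂)).count (B₁ ×ˢ B₂) : ℝ≥0∞) ∂P ∂P := by
        rw [hΨ.matchingIntensity_apply hC, lintegral_prod _ (hΨ.aemeasurable_count hC)]
    _ ≤ ∫⁻ ω₁, ∫⁻ ω₂, (ω₁.count B₁ : ℝ≥0∞) * ω₂.count B₂ ∂P ∂P := by
        refine lintegral_mono_ae <| (hΨ.count_prod_le B₁ B₂ hB₁ hB₂).mono fun ω₁ h =>
          lintegral_mono_ae (h.mono fun ω₂ h' => ?_)
        rw [← ENat.toENNReal_mul, ENat.toENNReal_le]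
        exact h'.trans (enat_min_le_mul _ _)
    _ = μ B₁ * μ B₂ := by
        simp_rw [lintegral_const_mul _ (Config.measurable_toENNReal_count hB₂)]
        rw [lintegral_mul_const _ (Config.measurable_toENNReal_count hB₁),
          hP.lintegral_count hB₁, hP.lintegral_count hB₂]

variable {G : Type*} [Group G] [MulAction G X] [MeasurableConstSMul G X]

theorem measurePreserving_smul_matchingIntensity [SFinite P]
    [SMulInvariantMeasure G (Config X) P] (hΨ : IsPoissonMatching P Ψ)
    (hE : IsEquivariantMatching G P Ψ) (g : G) :
    MeasurePreserving (g • · : X × X → X × X) (matchingIntensity P Ψ) (matchingIntensity P Ψ) := by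
  have hg : Measurable (g • · : X × X → X × X) := measurable_const_smul g
  have hPP : MeasurePreserving (fun ω : Config X × Config X => (g • ω.1, g • ω.2))
      (P.prod P) (P.prod P) := (measurePreserving_smul g P).prod (measurePreserving_smul g P)
  refine ⟨hg, Measure.ext fun C hC => ?_⟩
  rw [Measure.map_apply hg hC]
  calc matchingIntensity P Ψ ((g • ·) ⁻¹' C)
      = ∫⁻ ω, ((g • Ψ ω).count C : ℝ≥0∞) ∂P.prod P := by
        simp only [hΨ.matchingIntensity_apply (hg hC), Config.count_smul]
    _ = ∫⁻ ω, ((Ψ (g • ω.1, g • ω.2)).count C : ℝ≥0∞) ∂P.prod P :=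
        lintegral_congr_ae ((hE g).mono fun ω hω => by simp only [hω])
    _ = ∫⁻ ω, ((Ψ ω).count C : ℝ≥0∞) ∂P.prod P := by
        conv_rhs => rw [← hPP.map_eq]
        exact (lintegral_map' (hPP.map_eq.symm ▸ hΨ.aemeasurable_count hC)
          hPP.aemeasurable).symm
    _ = matchingIntensity P Ψ C := (hΨ.matchingIntensity_apply hC).symm

theorem rnDeriv_matchingIntensity_comp_smul_ae_eq [SigmaFinite μ] [SMulInvariantMeasure G X μ]
    [SMulInvariantMeasure G (Config X) P] (hP : IsPoissonProcess μ P)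
    (hΨ : IsPoissonMatching P Ψ) (hE : IsEquivariantMatching G P Ψ) (g : G) :
    (matchingIntensity P Ψ).rnDeriv (μ.prod μ) ∘ (g • ·) =ᵐ[μ.prod μ]
      (matchingIntensity P Ψ).rnDeriv (μ.prod μ) := by
  have := hP.isProbabilityMeasure
  have hle := hΨ.matchingIntensity_le_prod hP
  have := Measure.sigmaFinite_of_le _ hle
  exact rnDeriv_comp_ae_eq_of_measurePreserving (Measure.absolutelyContinuous_of_le hle)
    (measurableEmbedding_const_smul g) (hΨ.measurePreserving_smul_matchingIntensity hE g)
    ((measurePreserving_smul g μ).prod (measurePreserving_smul g μ))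

end IsPoissonMatching

theorem mainTheorem8_general {X : Type*} [MeasurableSpace X] (μ : Measure X) [SigmaFinite μ]
    (hμ : μ ≠ 0) {G : Type*} [Group G] [MulAction G X] [MeasurableConstSMul G X]
    [SMulInvariantMeasure G X μ] (P : Measure (Config X)) (hP : IsPoissonProcess μ P)
    (hS : ErgodicSMul G (X × Config X) (μ.prod P)) :
    ¬ ∃ Ψ : Config X × Config X → Config (X × X),
      IsPoissonMatching P Ψ ∧ IsEquivariantMatching G P Ψ := by
  rintro ⟨Ψ, hΨ, hE⟩
  have := hP.isProbabilityMeasure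
  have : NeZero μ := ⟨hμ⟩
  have : SMulInvariantMeasure G (Config X) P := smulInvariantMeasure_snd_of_prod (μ := μ)
  have hle := hΨ.matchingIntensity_le_prod hP
  have := Measure.sigmaFinite_of_le _ hle
  have hint_one := ae_lintegral_rnDeriv_prod_eq_one (Measure.absolutelyContinuous_of_le hle)
    (hΨ.fst_matchingIntensity hP)
  have hzero := hP.ae_ae_eq_zero_of_invariant hS (Measure.measurable_rnDeriv _ _)
    (hΨ.rnDeriv_matchingIntensity_comp_smul_ae_eq hP hE)
    (hint_one.mono fun x hx => hx ▸ ENNReal.one_ne_top)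
  obtain ⟨x, hx_one, hx_zero⟩ := (hint_one.and hzero).exists
  exact one_ne_zero (hx_one.symm.trans (lintegral_eq_zero_of_ae_eq_zero hx_zero))

theorem mainTheorem8 {X : Type*} [MeasurableSpace X] [StandardBorelSpace X]
    (μ : Measure X) [SigmaFinite μ] [NullSingletonClass μ] (hμ : μ ≠ 0)
    {G : Type*} [Group G] [MulAction G X] [MeasurableConstSMul G X] [SMulInvariantMeasure G X μ]
    -- `P = μ^*`, the law of the Poisson process on `X` with intensity `μ`
    (P : Measure (Config X)) (hP : IsPoissonProcess μ P)
    -- `Q = (μ × μ^*)^*`, the law of the Poisson process on `X × X^*` with intensity `μ × μ^*`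
    (Q : Measure (Config (X × Config X))) (hQ : IsPoissonProcess (μ.prod P) Q)
    -- with `S = T × T_*` the action on `X × X^*`, the action `S × S_*` is ergodic
    (hS : ErgodicSMul G ((X × Config X) × Config (X × Config X)) ((μ.prod P).prod Q)) :
    ¬ ∃ Ψ : Config X × Config X → Config (X × X),
      IsPoissonMatching P Ψ ∧ IsEquivariantMatching G P Ψ := by
  have := hP.isProbabilityMeasure
  have := hQ.isProbabilityMeasure
  exact mainTheorem8_general μ hμ P hP (ergodicSMul_fst_of_prod hS)
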